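/- Let $n\ge 1$ and $k\ge 2$ be integers with $k\mid n$. Let $\mathbb S^n$ be the space of real symmetric $n\times n$ matrices with $\langle X,Y\rangle=\mathrm{tr}(XY)$, let $\mathbb S^{(n,k)}=\prod_{J\subseteq[n],|J|=k}\mathbb S^k$ with inner product $\sum_J\langle X_J,Y_J\rangle$, and let $\Psi:\mathbb S^{(n,k)}\to\mathbb S^n$, $\Psi(\mathcal Y)=\sum_{|J|=k}Y_J^{\to n}$, where $Y_J^{\to n}$ is the $n\times n$ matrix that has $Y_J$ as its principal submatrix indexed by $J$ and zeros elsewhere. Put $\mathcal Y_0=\big(\binom{n-1}{k-1}^{-1}I_k\big)_{J}$ and $f^{\mathrm{FW}(k)}(\mathcal Y)=-\sum_{|J|=k}\log\det Y_J$ (for positive definite blocks). For a function $f$ with gradient $g(x)$ and positive definite Hessian $H(x)$ at a point $x$ of an affine subspace $L$, the Newton decrement of the restriction $f_{|L}$ at $x$ is $\Delta(f_{|L},x)=\|P_{L,x}H(x)^{-1}g(x)\|_x$, where $\langle u,w\rangle_x=\langle u,H(x)w\rangle$, $\|\cdot\|_x$ is the corresponding norm, and $P_{L,x}$ is the $\langle\cdot,\cdot\rangle_x$-orthogonal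 projection onto the linear subspace parallel to $L$. Let $A_0,\dots,A_m\in\mathbb S^n$ and $b\in\mathbb R^m$, and let $X_\ell\succeq0$ satisfy $\langle A_i,X_\ell\rangle=b_i$ for $i=1,\dots,m$; put $v=\langle A_0,X_\ell\rangle$ and $A_i^{(\ell)}=X_\ell^{1/2}A_iX_\ell^{1/2}$ for $i=0,\dots,m$. Define $$L_\ell=\{X\in\mathbb S^n:\langle A_i^{(\ell)},X\rangle=b_i,\ i=1,\dots,m\},$$ $$L^\Psi_\ell(v)=\{\mathcal Y\in\mathbb S^{(n,k)}:\langle A_0^{(\ell)},\Psi(\mathcal Y)\rangle=v,\ \langle A_i^{(\ell)},\Psi(\mathcal Y)\rangle=b_i,\ i=1,\dots,m\},$$ and, for $\eta\in\mathbb R$ and $X\succ0$, $f^{\mathrm{SDP}}_{\eta}(X)=\eta\langle A_0^{(\ell)},X\rangle-\log\det X$. Suppose that $$\Delta\big(f^{\mathrm{FW}(k)}_{|L^\Psi_\ell(v)},\mathcal Y_0\big)\le\tfrac1{14}.$$ Then there is a real number $\eta_v$ such that $f^{\mathrm{SDP}}_{\eta_v}$ has a minimizer over $\{X\in L_\ell:X\succ0\}$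 whose objective value $\langle A_0^{(\ell)},X\rangle$ equals $v$, and every such $\eta_v$ satisfies $$\Delta\big((f^{\mathrm{SDP}}_{\eta_v})_{|L_\ell},I\big)\le\tfrac19.$$ -/

import Mathlib

open scoped InnerProductSpace

noncomputable section

namespace FactorWidth

/-! ### Symmetric matrices with the trace inner product -/

/-- The real symmetric matrices, as a linear subspace of all square matrices. -/
def symSubmodule (ι : Type) [Fintype ι] : Submodule ℝ (Matrix ι ι ℝ) where
  carrier := {X | X.IsSymm}
  add_mem' hX hY := hX.add hY
  zero_mem' := Matrix.isSymm_zero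
  smul_mem' c _ hX := hX.smul c

/-- The space of real symmetric matrices indexed by `ι`. It is a type of its own, so that its
norm is the one that comes from the trace inner product. -/
def SymMat (ι : Type) [Fintype ι] : Type := symSubmodule ι

namespace SymMat

variable {ι : Type} [Fintype ι]

instance : AddCommGroup (SymMat ι) := inferInstanceAs (AddCommGroup (symSubmodule ι))

instance : Module ℝ (SymMat ι) := inferInstanceAs (Module ℝ (symSubmodule ι))

instance : FiniteDimensional ℝ (SymMat ι) :=
  inferInstanceAs (FiniteDimensional ℝ (symSubmodule ι))

/-- The underlying matrix, as a linear map. -/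
def mat : SymMat ι →ₗ[ℝ] Matrix ι ι ℝ := (symSubmodule ι).subtype

/-- A symmetric matrix as an element of `SymMat ι`. -/
def mk (X : Matrix ι ι ℝ) (hX : X.IsSymm) : SymMat ι := (⟨X, hX⟩ : symSubmodule ι)

@[simp]
theorem mat_mk (X : Matrix ι ι ℝ) (hX : X.IsSymm) : (mk X hX).mat = X := rfl

theorem isSymm (X : SymMat ι) : X.mat.IsSymm := X.2

theorem mat_injective : Function.Injective (mat : SymMat ι → Matrix ι ι ℝ) :=
  Subtype.val_injective

/-- The trace inner product `⟨X, Y⟩ = tr (X Y)`. -/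
abbrev core : InnerProductSpace.Core ℝ (SymMat ι) where
  inner X Y := (X.mat * Y.mat).trace
  conj_inner_symm X Y := by
    simpa using Matrix.trace_mul_comm Y.mat X.mat
  re_inner_nonneg X := by
    have h : (X.mat * X.mat).trace = ∑ i, ∑ j, X.mat i j ^ 2 := by
      simp only [Matrix.trace, Matrix.diag, Matrix.mul_apply]
      refine Finset.sum_congr rfl fun i _ => Finset.sum_congr rfl fun j _ => ?_
      rw [← X.isSymm.apply i j, pow_two]
    change 0 ≤ (X.mat * X.mat).trace
    rw [h]
    positivity
  add_left X Y Z := by simp [add_mul]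
  smul_left X Y r := by simp
  definite X hX := by
    have h : (X.mat * X.mat).trace = ∑ i, ∑ j, X.mat i j ^ 2 := by
      simp only [Matrix.trace, Matrix.diag, Matrix.mul_apply]
      refine Finset.sum_congr rfl fun i _ => Finset.sum_congr rfl fun j _ => ?_
      rw [← X.isSymm.apply i j, pow_two]
    have h0 : ∑ i, ∑ j, X.mat i j ^ 2 = 0 := h.symm.trans hX
    apply mat_injective
    ext i j
    have h1 := (Finset.sum_eq_zero_iff_of_nonneg
      (fun i _ => Finset.sum_nonneg fun j _ => sq_nonneg (X.mat i j))).1 h0 i (Finset.mem_univ i)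
    have h2 := (Finset.sum_eq_zero_iff_of_nonneg
      (fun j _ => sq_nonneg (X.mat i j))).1 h1 j (Finset.mem_univ j)
    simpa using h2

instance : NormedAddCommGroup (SymMat ι) := (core (ι := ι)).toNormedAddCommGroup

instance : InnerProductSpace ℝ (SymMat ι) := InnerProductSpace.ofCore core.toCore

instance : CompleteSpace (SymMat ι) := FiniteDimensional.complete ℝ _

theorem inner_def (X Y : SymMat ι) : ⟪X, Y⟫_ℝ = (X.mat * Y.mat).trace := rfl

/-- The identity matrix. -/
def id [DecidableEq ι] : SymMat ι := mk 1 Matrix.isSymm_one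

end SymMat

/-! ### Newton decrements -/

section Newton

variable {E : Type} [NormedAddCommGroup E] [InnerProductSpace ℝ E] [CompleteSpace E]

/-- The Hessian `H(x)` of `f`: the derivative of the gradient. -/
def hessian (f : E → ℝ) (x : E) : E →L[ℝ] E := fderiv ℝ (gradient f) x

/-- The local inner product `⟨u, w⟩_x = ⟨u, H(x) w⟩`. -/
def localInner (f : E → ℝ) (x u w : E) : ℝ := ⟪u, hessian f x w⟫_ℝ

/-- The local norm `‖u‖_x`. -/
def localNorm (f : E → ℝ) (x u : E) : ℝ := √(localInner f x u u)

/-- The projection `P_{V,x} w` of `w` onto the linear subspace `V`, orthogonal for the local inner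
product at `x`: the point `p` of `V` with `⟨u, w - p⟩_x = 0` for all `u` in `V`. (There is exactly
one such point when `H(x)` is positive definite and `E` is finite-dimensional.) -/
def localProj (f : E → ℝ) (x : E) (V : Submodule ℝ E) (w : E) : E :=
  Classical.epsilon fun p => p ∈ V ∧ ∀ u ∈ V, localInner f x u (w - p) = 0

/-- The Newton decrement `Δ(f|_L, x) = ‖P_{L,x} H(x)⁻¹ g(x)‖_x` of the restriction of `f` to the
translated linear subspace `L`; the projection is onto the linear subspace parallel to `L`. -/
def newtonDecrement (f : E → ℝ) (L : AffineSubspace ℝ E) (x : E) : ℝ :=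
  localNorm f x (localProj f x L.direction ((hessian f x).inverse (gradient f x)))

end Newton

/-! ### The affine solution set of a linear system -/

/-- The solution set `{x | T x = c}` of a linear system. -/
def solutionSet {E F : Type} [AddCommGroup E] [Module ℝ E] [AddCommGroup F] [Module ℝ F]
    (T : E →ₗ[ℝ] F) (c : F) : AffineSubspace ℝ E where
  carrier := {x | T x = c}
  smul_vsub_vadd_mem' r p q s hp hq hs := by
    change T _ = c at hp hq hs ⊢
    simp [hp, hq, hs]

/-! ### Products of small symmetric matrices -/

/-- The index sets `J ⊆ [n]` with `|J| = k`. -/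
abbrev Blocks (n k : ℕ) : Type := {J : Finset (Fin n) // J.card = k}

/-- The space `𝕊^(n,k)` of families `(Y_J)` of symmetric `k × k` matrices, with the inner product
`∑ J, ⟨X_J, Y_J⟩`. -/
abbrev SymBlocks (n k : ℕ) : Type := PiLp 2 fun _ : Blocks n k => SymMat (Fin k)

/-- For `J = {i_1 < ⋯ < i_k}` and a `k × k` matrix `S`, the `n × n` matrix with entry `S a b` at
`(i_a, i_b)`, and zeros elsewhere. -/
def expand {n k : ℕ} (J : Blocks n k) (S : Matrix (Fin k) (Fin k) ℝ) :
    Matrix (Fin n) (Fin n) ℝ :=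
  Matrix.of fun i j =>
    if h : i ∈ J.1 ∧ j ∈ J.1 then
      S ((J.1.orderIsoOfFin J.2).symm ⟨i, h.1⟩) ((J.1.orderIsoOfFin J.2).symm ⟨j, h.2⟩)
    else 0

theorem expand_isSymm {n k : ℕ} (J : Blocks n k) {S : Matrix (Fin k) (Fin k) ℝ}
    (hS : S.IsSymm) : (expand J S).IsSymm := by
  ext i j
  simp only [expand, Matrix.transpose_apply, Matrix.of_apply]
  by_cases h : i ∈ J.1 ∧ j ∈ J.1
  · rw [dif_pos h, dif_pos h.symm]
    exact hS.apply _ _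
  · rw [dif_neg h, dif_neg fun h' => h h'.symm]

/-- `expand` on symmetric matrices, as a linear map. -/
def expandSym {n k : ℕ} (J : Blocks n k) : SymMat (Fin k) →ₗ[ℝ] SymMat (Fin n) where
  toFun S := SymMat.mk (expand J S.mat) (expand_isSymm J S.isSymm)
  map_add' S T := by
    apply SymMat.mat_injective
    ext i j
    simp only [SymMat.mat_mk, map_add, Matrix.add_apply, expand, Matrix.of_apply]
    split_ifs <;> simp
  map_smul' c S := by
    apply SymMat.mat_injective
    ext i j
    simp only [SymMat.mat_mk, map_smul, Matrix.smul_apply, expand, Matrix.of_apply,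
      RingHom.id_apply]
    split_ifs <;> simp

/-- The operator `Ψ(𝒴) = ∑ J, (Y_J)^{→n}`. -/
def Psi (n k : ℕ) : SymBlocks n k →ₗ[ℝ] SymMat (Fin n) where
  toFun Y := ∑ J, expandSym J (Y J)
  map_add' Y Z := by simp [Finset.sum_add_distrib]
  map_smul' c Y := by simp [Finset.smul_sum]

/-- The point `𝒴₀`, all of whose blocks are the identity divided by `(n-1).choose (k-1)`. -/
def Y0 (n k : ℕ) : SymBlocks n k :=
  WithLp.toLp 2 fun _ => (((n - 1).choose (k - 1) : ℝ)⁻¹) • SymMat.id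

/-- The barrier `-∑ J, log det Y_J` of the product of the cones of positive semidefinite
`k × k` matrices (meaningful where all blocks are positive definite). -/
def fFW (n k : ℕ) (Y : SymBlocks n k) : ℝ := -∑ J, Real.log (Y J).mat.det

/-! ### The rescaled semidefinite program -/

section SDP

open scoped MatrixOrder

variable {n m : ℕ}

theorem sqrt_isSymm (X : Matrix (Fin n) (Fin n) ℝ) : (CFC.sqrt X).IsSymm := by
  have h := (Matrix.nonneg_iff_posSemidef.1 (CFC.sqrt_nonneg X)).isHermitian
  simpa only [Matrix.IsSymm, Matrix.IsHermitian, Matrix.conjTranspose_eq_transpose_of_trivial]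
    using h

/-- The rescaled matrix `X^{1/2} A X^{1/2}`. -/
def rescale (X A : SymMat (Fin n)) : SymMat (Fin n) :=
  SymMat.mk (CFC.sqrt X.mat * A.mat * CFC.sqrt X.mat) (by
    have h := sqrt_isSymm X.mat
    have hA := A.isSymm
    simp only [Matrix.IsSymm] at h hA ⊢
    simp [Matrix.transpose_mul, h, hA, Matrix.mul_assoc])

/-- The operator `X ↦ (⟨A_i, X⟩)_i` of a family of symmetric matrices. -/
def traceOp {ι : Type} (A : ι → SymMat (Fin n)) : SymMat (Fin n) →ₗ[ℝ] (ι → ℝ) :=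
  LinearMap.pi fun i => (innerₗ (SymMat (Fin n))) (A i)

/-- `L_ℓ`: the matrices `Z` with `⟨A_i^(ℓ), Z⟩ = b_i` for `i = 1, …, m`, where
`A_i^(ℓ) = X^{1/2} A_i X^{1/2}` and `X` is the current iterate. The objective `A_0` is the entry
`A 0` of the family `A`, and the constraint `A_i` is the entry `A i.succ`. -/
def Lell (A : Fin (m + 1) → SymMat (Fin n)) (b : Fin m → ℝ) (X : SymMat (Fin n)) :
    AffineSubspace ℝ (SymMat (Fin n)) :=
  solutionSet (traceOp fun i : Fin m => rescale X (A i.succ)) b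

/-- `L^Ψ_ℓ(v)`: the families `𝒴` with `⟨A_i^(ℓ), Ψ(𝒴)⟩ = b_i` for `i = 1, …, m` and
`⟨A_0^(ℓ), Ψ(𝒴)⟩ = v`. -/
def LPsi (k : ℕ) (A : Fin (m + 1) → SymMat (Fin n)) (b : Fin m → ℝ) (X : SymMat (Fin n))
    (v : ℝ) : AffineSubspace ℝ (SymBlocks n k) :=
  solutionSet (traceOp (fun i : Fin (m + 1) => rescale X (A i)) ∘ₗ Psi n k)
    (Fin.cons v b : Fin (m + 1) → ℝ)

/-- The functional `η ⟨A_0^(ℓ), Z⟩ - log det Z` (meaningful for positive definite `Z`). -/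
def fSDP (A0 X : SymMat (Fin n)) (η : ℝ) (Z : SymMat (Fin n)) : ℝ :=
  η * ⟪rescale X A0, Z⟫_ℝ - Real.log Z.mat.det

/-- `η` is a parameter `η_v`: over the positive definite matrices in `L_ℓ`, the functional
`η ⟨A_0^(ℓ), Z⟩ - log det Z` has a minimizer whose objective value `⟨A_0^(ℓ), Z⟩` is `v`. -/
def IsCentralParameter (A : Fin (m + 1) → SymMat (Fin n)) (b : Fin m → ℝ) (X : SymMat (Fin n))
    (v η : ℝ) : Prop :=
  ∃ Z : SymMat (Fin n), Z ∈ Lell A b X ∧ Z.mat.PosDef ∧ ⟪rescale X (A 0), Z⟫_ℝ = v ∧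
    ∀ W : SymMat (Fin n), W ∈ Lell A b X → W.mat.PosDef →
      fSDP (A 0) X η Z ≤ fSDP (A 0) X η W

end SDP

end FactorWidth

end

open FactorWidth

/-! Everything passes through the trace on V, the common kernel of the functionals ⟨A_i^(ℓ), ·⟩, i =
0, …, m. Let q = C(n-1, k-1). At 𝒴₀ the factor-width barrier has gradient -q²𝒴₀ and Hessian q² times
the identity, so its decrement is q times the norm of the Euclidean projection of 𝒴₀ onto Ψ⁻¹(V).
Since q⟨𝒴, 𝒴₀⟩ = tr Ψ(𝒴), and Ψ has a norm-nonincreasing linear right inverse (`spread`), the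
hypothesis gives |tr U| ≤ ‖U‖/14 on V (`abs_trace_le_of_newtonDecrement_le`).

The stability estimate is `SymMat.norm_sub_id_le`. If Z ≻ 0, Z - I ∈ V and ⟨Z⁻¹, Z - I⟩ ≥ 0, then
the eigenvalues λ of Z satisfy ∑ (λ-1)²/λ = tr(Z-I) - ⟨Z⁻¹, Z-I⟩ ≤ ‖Z-I‖/14, so ‖Z-I‖ ≤ 1/13 and
‖Z⁻¹-I‖ ≤ 1/12.

Existence: a maximizer of log det on I + V within a ball about I satisfies the estimate, so it is
interior and critical; Lagrange multipliers then give η_v. Bound: a central point Z with value v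
satisfies it too, and the Newton step at I has length at most ‖Z⁻¹-I‖ ≤ 1/12 < 1/9. -/

noncomputable section

open scoped InnerProductSpace

namespace FactorWidth

/-! ### Positive definiteness and the trace norm -/

namespace SymMat

variable {ι : Type} [Fintype ι]

theorem norm_sq_eq_sum (X : SymMat ι) : ‖X‖ ^ 2 = ∑ i, ∑ j, X.mat i j ^ 2 := by
  rw [← real_inner_self_eq_norm_sq, inner_def]
  simp only [Matrix.trace, Matrix.diag, Matrix.mul_apply]
  refine Finset.sum_congr rfl fun i _ => Finset.sum_congr rfl fun j _ => ?_
  rw [← X.isSymm.apply i j, pow_two]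

theorem isHermitian (X : SymMat ι) : X.mat.IsHermitian := by
  rw [Matrix.IsHermitian, Matrix.conjTranspose_eq_transpose_of_trivial]
  exact X.isSymm

/-- The rank-one matrix `x xᵀ`. -/
def outer (x : ι → ℝ) : SymMat ι :=
  mk (Matrix.vecMulVec x x) (by ext i j; simp [Matrix.vecMulVec_apply, mul_comm])

theorem mat_outer (x : ι → ℝ) : (outer x).mat = Matrix.vecMulVec x x := rfl

theorem norm_outer (x : ι → ℝ) : ‖outer x‖ = x ⬝ᵥ x := by
  have h : ‖outer x‖ ^ 2 = (x ⬝ᵥ x) ^ 2 := by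
    rw [norm_sq_eq_sum, pow_two, dotProduct, Finset.sum_mul_sum]
    refine Finset.sum_congr rfl fun i _ => Finset.sum_congr rfl fun j _ => ?_
    rw [mat_outer, Matrix.vecMulVec_apply]
    ring
  have h0 : 0 ≤ x ⬝ᵥ x := Finset.sum_nonneg fun i _ => mul_self_nonneg (x i)
  exact (pow_left_inj₀ (norm_nonneg _) h0 two_ne_zero).1 h

theorem inner_outer (D : SymMat ι) (x : ι → ℝ) : ⟪D, outer x⟫_ℝ = x ⬝ᵥ D.mat.mulVec x := by
  rw [inner_def, mat_outer, Matrix.mul_vecMulVec, Matrix.trace_vecMulVec, dotProduct_comm]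

theorem abs_quadratic_le (D : SymMat ι) (x : ι → ℝ) :
    |x ⬝ᵥ D.mat.mulVec x| ≤ ‖D‖ * (x ⬝ᵥ x) := by
  rw [← inner_outer, ← norm_outer]
  exact abs_real_inner_le_norm _ _

/-- The linear map `X ↦ Sᵀ X S`. -/
def congruence (S : Matrix ι ι ℝ) : SymMat ι →ₗ[ℝ] SymMat ι where
  toFun X := mk (S.transpose * X.mat * S) (by
    have hX := X.isSymm
    simp only [Matrix.IsSymm] at hX ⊢
    simp [Matrix.transpose_mul, hX, Matrix.mul_assoc])
  map_add' X Y := mat_injective (by simp [Matrix.mul_add, Matrix.add_mul])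
  map_smul' c X := mat_injective (by simp)

theorem mat_congruence (S : Matrix ι ι ℝ) (X : SymMat ι) :
    (congruence S X).mat = S.transpose * X.mat * S := rfl

/-- The symmetric part of a matrix. -/
def symPart : Matrix ι ι ℝ →ₗ[ℝ] SymMat ι where
  toFun M := mk ((2 : ℝ)⁻¹ • (M + M.transpose)) (by
    simp [Matrix.IsSymm, add_comm])
  map_add' X Y := mat_injective (by simp; abel)
  map_smul' c X := mat_injective (by simp [smul_comm c])

theorem symPart_mat (X : SymMat ι) : symPart X.mat = X := by
  apply mat_injective
  have hX : X.mat.transpose = X.mat := X.isSymm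
  simp only [symPart, LinearMap.coe_mk, AddHom.coe_mk, mat_mk, hX, ← two_smul ℝ X.mat, smul_smul]
  norm_num

variable [DecidableEq ι]

@[simp]
theorem mat_id : (id : SymMat ι).mat = 1 := rfl

theorem inner_id (X : SymMat ι) : ⟪X, id⟫_ℝ = X.mat.trace := by simp [inner_def]

theorem posDef_of_norm_sub_id_lt {X : SymMat ι} (h : ‖X - id‖ < 1) : X.mat.PosDef := by
  refine Matrix.PosDef.of_dotProduct_mulVec_pos X.isHermitian fun x hx => ?_
  have h1 := abs_le.1 (abs_quadratic_le (X - id) x)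
  have h2 : 0 < x ⬝ᵥ x := by
    simpa using Matrix.dotProduct_star_self_pos_iff.2 hx
  have h3 : x ⬝ᵥ (X - id).mat.mulVec x = x ⬝ᵥ X.mat.mulVec x - x ⬝ᵥ x := by
    simp [Matrix.sub_mulVec, dotProduct_sub]
  rw [h3] at h1
  simp only [star_trivial]
  nlinarith [h1.1]

open scoped MatrixOrder Matrix.Norms.L2Operator in
-- Factor Z = BᵀB and take S = B⁻¹. This moves questions at Z to the identity.
theorem exists_congruence_eq_id {Z : SymMat ι} (hZ : Z.mat.PosDef) :
    ∃ S : Matrix ι ι ℝ, IsUnit S ∧ S * S.transpose = Z.mat⁻¹ ∧ congruence S Z = id := by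
  obtain ⟨B, hB, hBZ⟩ : ∃ B : Matrix ι ι ℝ, IsUnit B ∧ Z.mat = B.transpose * B := by
    obtain ⟨B, hB⟩ := CStarAlgebra.nonneg_iff_eq_star_mul_self.1
      (Matrix.nonneg_iff_posSemidef.2 hZ.posSemidef)
    rw [Matrix.star_eq_conjTranspose, Matrix.conjTranspose_eq_transpose_of_trivial] at hB
    refine ⟨B, ?_, hB⟩
    rw [Matrix.isUnit_iff_isUnit_det, isUnit_iff_ne_zero]
    intro h0
    have := hZ.det_pos.ne'
    rw [hB, Matrix.det_mul, h0, mul_zero] at this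
    exact this rfl
  have hdet : IsUnit B.det := (Matrix.isUnit_iff_isUnit_det _).1 hB
  refine ⟨B⁻¹, (Matrix.isUnit_nonsing_inv_iff).2 hB, ?_, mat_injective ?_⟩
  · rw [hBZ, Matrix.mul_inv_rev, Matrix.transpose_nonsing_inv]
  · rw [mat_congruence, hBZ, Matrix.transpose_nonsing_inv, mat_id]
    have hdetT : IsUnit B.transpose.det := by simpa using hdet
    rw [Matrix.mul_assoc, Matrix.mul_assoc, Matrix.mul_nonsing_inv _ hdet, Matrix.mul_one,
      Matrix.nonsing_inv_mul _ hdetT]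

theorem posDef_congruence_iff {S : Matrix ι ι ℝ} (hS : IsUnit S) (X : SymMat ι) :
    (congruence S X).mat.PosDef ↔ X.mat.PosDef := by
  rw [mat_congruence, ← Matrix.conjTranspose_eq_transpose_of_trivial]
  exact Matrix.IsUnit.posDef_star_left_conjugate_iff hS

theorem eventually_posDef {Z : SymMat ι} (hZ : Z.mat.PosDef) :
    ∀ᶠ W in nhds Z, W.mat.PosDef := by
  obtain ⟨S, hS, -, hSZ⟩ := exists_congruence_eq_id hZ
  have hc : Continuous fun W => ‖congruence S W - id‖ :=
    ((LinearMap.continuous_of_finiteDimensional _).sub continuous_const).norm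
  have h0 : ‖congruence S Z - id‖ < 1 := by simp [hSZ]
  filter_upwards [hc.continuousAt.eventually_lt_const h0] with W hW
  exact (posDef_congruence_iff hS W).1 (posDef_of_norm_sub_id_lt hW)

/-! ### Calculus of log det and a spectral stability estimate -/

theorem log_det_le_trace_sub_card {M : SymMat ι} (hM : M.mat.PosDef) :
    Real.log M.mat.det ≤ M.mat.trace - Fintype.card ι := by
  rw [hM.isHermitian.det_eq_prod_eigenvalues, hM.isHermitian.trace_eq_sum_eigenvalues]
  simp only [RCLike.ofReal_real_eq_id, id_eq]
  rw [Real.log_prod fun i _ => (hM.eigenvalues_pos i).ne']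
  have : ∑ i, Real.log (hM.isHermitian.eigenvalues i)
      ≤ ∑ i, (hM.isHermitian.eigenvalues i - 1) :=
    Finset.sum_le_sum fun i _ => Real.log_le_sub_one_of_pos (hM.eigenvalues_pos i)
  simpa using this

/-- The inverse of a symmetric matrix. -/
def inv (X : SymMat ι) : SymMat ι :=
  mk X.mat⁻¹ (by
    have hX : X.mat.transpose = X.mat := X.isSymm
    simp [Matrix.IsSymm, Matrix.transpose_nonsing_inv, hX])

@[simp]
theorem mat_inv (X : SymMat ι) : X.inv.mat = X.mat⁻¹ := rfl

theorem inner_inv_self {Z : SymMat ι} (hZ : Z.mat.PosDef) : ⟪Z.inv, Z⟫_ℝ = Fintype.card ι := by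
  rw [inner_def, mat_inv, Matrix.nonsing_inv_mul _ hZ.det_pos.ne'.isUnit, Matrix.trace_one]

/-- Concavity of `log det`: the graph lies below its tangents. -/
theorem log_det_le_add_inner {W Z : SymMat ι} (hW : W.mat.PosDef) (hZ : Z.mat.PosDef) :
    Real.log W.mat.det ≤ Real.log Z.mat.det + ⟪Z.inv, W - Z⟫_ℝ := by
  -- A congruence taking Z to I reduces the claim to log λ ≤ λ - 1 on eigenvalues.
  obtain ⟨S, hS, hSS, hSZ⟩ := exists_congruence_eq_id hZ
  have h := log_det_le_trace_sub_card ((posDef_congruence_iff hS W).2 hW)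
  have htr : (congruence S W).mat.trace = ⟪Z.inv, W⟫_ℝ := by
    rw [mat_congruence, inner_def, mat_inv, ← hSS, Matrix.trace_mul_comm, Matrix.mul_assoc]
  have hdet : (congruence S W).mat.det = W.mat.det / Z.mat.det := by
    have h1 : S.det * S.det = (Z.mat.det)⁻¹ := by
      have := congrArg Matrix.det hSS
      rw [Matrix.det_mul, Matrix.det_transpose, Matrix.det_nonsing_inv, Ring.inverse_eq_inv'] at this
      exact this
    rw [mat_congruence, Matrix.det_mul, Matrix.det_mul, Matrix.det_transpose, div_eq_mul_inv, ← h1]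
    ring
  rw [hdet, htr, Real.log_div hW.det_pos.ne' hZ.det_pos.ne'] at h
  rw [inner_sub_right, inner_inv_self hZ]
  linarith

open scoped Matrix.Norms.Operator in
-- Inversion is differentiated in the full matrix algebra; `symPart`, a left inverse of `mat`,
-- brings the result back to symmetric matrices.
theorem hasFDerivAt_inv {Z : SymMat ι} (hZ : IsUnit Z.mat) :
    HasFDerivAt (inv : SymMat ι → SymMat ι)
      (-LinearMap.toContinuousLinearMap (congruence Z.mat⁻¹)) Z := by
  obtain ⟨u, hu⟩ := hZ
  have h1 := hasFDerivAt_ringInverse (𝕜 := ℝ) (R := Matrix ι ι ℝ) u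
  rw [hu] at h1
  have h2 : HasFDerivAt (fun X : SymMat ι => X.mat)
      (LinearMap.toContinuousLinearMap (mat : SymMat ι →ₗ[ℝ] Matrix ι ι ℝ)) Z :=
    (LinearMap.toContinuousLinearMap (mat : SymMat ι →ₗ[ℝ] Matrix ι ι ℝ)).hasFDerivAt
  have h3 := (LinearMap.toContinuousLinearMap
    (symPart : Matrix ι ι ℝ →ₗ[ℝ] SymMat ι)).hasFDerivAt.comp Z (h1.comp Z h2)
  have hZT : (Z.mat⁻¹).transpose = Z.mat⁻¹ := Z.inv.isSymm
  refine (h3.congr_fderiv ?_).congr_of_eventuallyEq (Filter.Eventually.of_forall fun X => ?_)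
  · ext1 U
    have hu' : ((u⁻¹ : (Matrix ι ι ℝ)ˣ) : Matrix ι ι ℝ) = Z.mat⁻¹ := by
      rw [← hu, Matrix.coe_units_inv]
    have : congruence Z.mat⁻¹ U = symPart (Z.mat⁻¹ * U.mat * Z.mat⁻¹) := by
      rw [← symPart_mat (congruence Z.mat⁻¹ U), mat_congruence, hZT]
    change symPart (-(((u⁻¹ : (Matrix ι ι ℝ)ˣ) : Matrix ι ι ℝ) * U.mat *
      ((u⁻¹ : (Matrix ι ι ℝ)ˣ) : Matrix ι ι ℝ))) = -congruence Z.mat⁻¹ U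
    rw [hu', this, map_neg]
  · simp only [Function.comp, LinearMap.coe_toContinuousLinearMap']
    rw [← Matrix.nonsing_inv_eq_ringInverse, ← mat_inv, symPart_mat]

theorem continuousAt_inv {Z : SymMat ι} (hZ : Z.mat.PosDef) :
    ContinuousAt (inv : SymMat ι → SymMat ι) Z :=
  (hasFDerivAt_inv hZ.isUnit).continuousAt

/-- By concavity the increment of log det lies between ⟨W⁻¹, W-Z⟩ and ⟨Z⁻¹, W-Z⟩; continuity of
inversion makes the gap o(‖W-Z‖). -/
theorem hasGradientAt_log_det {Z : SymMat ι} (hZ : Z.mat.PosDef) :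
    HasGradientAt (fun X : SymMat ι => Real.log X.mat.det) Z.inv Z := by
  rw [hasGradientAt_iff_isLittleO, Asymptotics.isLittleO_iff]
  intro c hc
  have hcont : ContinuousAt (fun W : SymMat ι => ‖W.inv - Z.inv‖) Z :=
    ((continuousAt_inv hZ).sub continuousAt_const).norm
  have h0 : ‖Z.inv - Z.inv‖ < c := by simpa using hc
  filter_upwards [eventually_posDef hZ, hcont.eventually_lt_const h0] with W hW hlt
  have h1 := log_det_le_add_inner hW hZ
  have h2 := log_det_le_add_inner hZ hW
  have h3 : -(‖W.inv - Z.inv‖ * ‖W - Z‖) ≤ ⟪W.inv - Z.inv, W - Z⟫_ℝ :=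
    (abs_le.1 (abs_real_inner_le_norm _ _)).1
  have h4 : ⟪W.inv, Z - W⟫_ℝ = -⟪W.inv, W - Z⟫_ℝ := by rw [← inner_neg_right, neg_sub]
  rw [inner_sub_left] at h3
  have h5 : ‖W.inv - Z.inv‖ * ‖W - Z‖ ≤ c * ‖W - Z‖ := by gcongr
  rw [Real.norm_eq_abs, abs_le]
  have h6 : 0 ≤ c * ‖W - Z‖ := by positivity
  constructor <;> linarith

/-- The spectral data of a positive definite matrix that the estimates below use. -/
theorem exists_spectrum {Z : SymMat ι} (hZ : Z.mat.PosDef) :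
    ∃ l : ι → ℝ, (∀ i, 0 < l i) ∧ ⟪Z - id, id⟫_ℝ = ∑ i, (l i - 1) ∧
      ⟪Z.inv, Z - id⟫_ℝ = ∑ i, (1 - (l i)⁻¹) ∧
      ‖Z - id‖ ^ 2 = ∑ i, (l i - 1) ^ 2 ∧ ‖Z.inv - id‖ ^ 2 = ∑ i, ((l i)⁻¹ - 1) ^ 2 := by
  set l := hZ.isHermitian.eigenvalues with hl
  have hpos : ∀ i, 0 < l i := fun i => hZ.eigenvalues_pos i
  obtain ⟨U, hU, hUZ⟩ : ∃ U : Matrix ι ι ℝ, U.transpose * U = 1 ∧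
      Z.mat = U * Matrix.diagonal l * U.transpose := by
    refine ⟨hZ.isHermitian.eigenvectorUnitary, ?_, ?_⟩
    · have := Unitary.coe_star_mul_self hZ.isHermitian.eigenvectorUnitary
      rwa [Matrix.star_eq_conjTranspose, Matrix.conjTranspose_eq_transpose_of_trivial] at this
    · have := hZ.isHermitian.spectral_theorem
      rw [Unitary.conjStarAlgAut_apply] at this
      simpa only [Matrix.star_eq_conjTranspose, Matrix.conjTranspose_eq_transpose_of_trivial,
        RCLike.ofReal_real_eq_id, Function.id_comp, Unitary.coe_star] using this
  have hU' : U * U.transpose = 1 := mul_eq_one_comm.1 hU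
  have hmul : ∀ d e : ι → ℝ, (U * Matrix.diagonal d * U.transpose) *
      (U * Matrix.diagonal e * U.transpose) =
        U * Matrix.diagonal (fun i => d i * e i) * U.transpose := fun d e => by
    calc _ = U * Matrix.diagonal d * (U.transpose * U) * Matrix.diagonal e * U.transpose := by
          simp only [Matrix.mul_assoc]
      _ = _ := by rw [hU, Matrix.mul_one, Matrix.mul_assoc U, Matrix.diagonal_mul_diagonal]
  have htr : ∀ d : ι → ℝ, (U * Matrix.diagonal d * U.transpose).trace = ∑ i, d i := fun d => by
    rw [Matrix.trace_mul_cycle, hU, Matrix.one_mul, Matrix.trace_diagonal]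
  have hone : (1 : Matrix ι ι ℝ) = U * Matrix.diagonal (fun _ => 1) * U.transpose := by
    rw [Matrix.diagonal_one, Matrix.mul_one, hU']
  have hinv : Z.mat⁻¹ = U * Matrix.diagonal (fun i => (l i)⁻¹) * U.transpose := by
    refine Matrix.inv_eq_right_inv ?_
    rw [hUZ, hmul, hone]
    congr 3
    ext i
    exact mul_inv_cancel₀ (hpos i).ne'
  have hsub : ∀ d e : ι → ℝ, U * Matrix.diagonal d * U.transpose -
      U * Matrix.diagonal e * U.transpose =
        U * Matrix.diagonal (fun i => d i - e i) * U.transpose := fun d e => by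
    rw [← Matrix.sub_mul, ← Matrix.mul_sub, Matrix.diagonal_sub]
  have h1 : (Z - id).mat = U * Matrix.diagonal (fun i => l i - 1) * U.transpose := by
    rw [map_sub, mat_id, hone, hUZ, hsub]
  have h2 : (Z.inv - id).mat = U * Matrix.diagonal (fun i => (l i)⁻¹ - 1) * U.transpose := by
    rw [map_sub, mat_id, hone, mat_inv, hinv, hsub]
  refine ⟨l, hpos, ?_, ?_, ?_, ?_⟩
  · rw [inner_id, h1, htr]
  · rw [inner_def, h1, mat_inv, hinv, hmul, htr]
    refine Finset.sum_congr rfl fun i _ => ?_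
    rw [mul_sub, inv_mul_cancel₀ (hpos i).ne', mul_one]
  · rw [← real_inner_self_eq_norm_sq, inner_def, h1, hmul, htr]
    simp only [pow_two]
  · rw [← real_inner_self_eq_norm_sq, inner_def, h2, hmul, htr]
    simp only [pow_two]

/-- If `log det` does not increase from `Z` towards the identity and the trace of `Z - I` is small
compared with its norm, then `Z` is close to the identity. -/
theorem norm_sub_id_le {Z : SymMat ι} (hZ : Z.mat.PosDef) (h : 0 ≤ ⟪Z.inv, Z - id⟫_ℝ)
    (htr : ⟪Z - id, id⟫_ℝ ≤ 1 / 14 * ‖Z - id‖) :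
    ‖Z - id‖ ≤ 1 / 13 ∧ ‖Z.inv - id‖ ≤ 1 / 12 := by
  obtain ⟨l, hl, h1, h2, h3, h4⟩ := exists_spectrum hZ
  set r := ‖Z - id‖ with hr
  have hr0 : 0 ≤ r := norm_nonneg _
  have habs : ∀ i, |l i - 1| ≤ r := fun i => by
    refine abs_le_of_sq_le_sq ?_ hr0
    rw [h3]
    exact Finset.single_le_sum (f := fun i => (l i - 1) ^ 2) (fun j _ => sq_nonneg _)
      (Finset.mem_univ i)
  -- Each term of the difference is (λ-1)²/λ, and λ ≤ 1 + r.
  have hlow : r ^ 2 / (1 + r) ≤ ∑ i, (l i - 1) - ∑ i, (1 - (l i)⁻¹) := by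
    rw [h3, Finset.sum_div, ← Finset.sum_sub_distrib]
    refine Finset.sum_le_sum fun i _ => ?_
    have h5 : l i - 1 - (1 - (l i)⁻¹) = (l i - 1) ^ 2 / l i := by
      have := (hl i).ne'
      field_simp
    rw [h5]
    have := (abs_le.1 (habs i)).2
    exact div_le_div_of_nonneg_left (sq_nonneg _) (hl i) (by linarith)
  rw [h1] at htr
  rw [h2] at h
  have hr1 : r ≤ 1 / 13 := by
    -- Unless r = 0, this says 14r ≤ 1 + r, that is, r ≤ 1/13.
    have h6 : r ^ 2 / (1 + r) ≤ 1 / 14 * r := by linarith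
    rw [div_le_iff₀ (by linarith)] at h6
    nlinarith
  refine ⟨hr1, ?_⟩
  -- Now λ ≥ 12/13, so |λ⁻¹ - 1| ≤ (13/12)|λ - 1|, and (13/12)(1/13) = 1/12.
  have h7 : ‖Z.inv - id‖ ^ 2 ≤ (13 / 12) ^ 2 * r ^ 2 := by
    rw [h4, h3, Finset.mul_sum]
    refine Finset.sum_le_sum fun i _ => ?_
    have h8 := (abs_le.1 (habs i)).1
    have h9 : (l i)⁻¹ ≤ 13 / 12 := by
      rw [inv_le_comm₀ (hl i) (by norm_num)]
      linarith
    have h10 : (l i)⁻¹ - 1 = -((l i)⁻¹ * (l i - 1)) := by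
      rw [mul_sub, inv_mul_cancel₀ (hl i).ne']
      ring
    rw [h10, neg_sq, mul_pow]
    have := (inv_pos.2 (hl i)).le
    gcongr
  have h11 : ‖Z.inv - id‖ ^ 2 ≤ (13 / 12 * r) ^ 2 := by rwa [mul_pow]
  have h12 := (pow_le_pow_iff_left₀ (norm_nonneg _) (by positivity) two_ne_zero).1 h11
  linarith

end SymMat

/-! ### Newton decrements at a scalar Hessian; directions of solution sets -/

section Newton

variable {E : Type} [NormedAddCommGroup E] [InnerProductSpace ℝ E] [FiniteDimensional ℝ E]
  [CompleteSpace E]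

/-- Where the Hessian is a positive multiple of the identity, the Newton decrement is a multiple of
the norm of a Euclidean projection. -/
theorem exists_newtonDecrement_eq {f : E → ℝ} {x : E} {c : ℝ} (hc : 0 < c)
    (hf : HasFDerivAt (gradient f) (c • ContinuousLinearMap.id ℝ E) x) (L : AffineSubspace ℝ E) :
    ∃ p ∈ L.direction, (∀ u ∈ L.direction, ⟪u, p⟫_ℝ = c⁻¹ * ⟪u, gradient f x⟫_ℝ) ∧
      newtonDecrement f L x = √c * ‖p‖ := by
  have hH : hessian f x = c • ContinuousLinearMap.id ℝ E := hf.fderiv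
  have hinv : (hessian f x).inverse = c⁻¹ • ContinuousLinearMap.id ℝ E := by
    rw [hH]
    refine ContinuousLinearMap.inverse_eq ?_ ?_ <;>
    · ext1 u
      simp [smul_smul, hc.ne']
  have hinner : ∀ u w, localInner f x u w = c * ⟪u, w⟫_ℝ := fun u w => by
    simp [localInner, hH, inner_smul_right]
  set w := (hessian f x).inverse (gradient f x) with hw
  have hw' : w = c⁻¹ • gradient f x := by rw [hw, hinv]; rfl
  -- The local inner product is c times the Euclidean one, so the Euclidean projection witnesses the
  -- `Classical.epsilon` choice.
  have hex : ∃ p, p ∈ L.direction ∧ ∀ u ∈ L.direction, localInner f x u (w - p) = 0 := by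
    refine ⟨L.direction.starProjection w, Submodule.starProjection_apply_mem _ _, fun u hu => ?_⟩
    rw [hinner, Submodule.inner_right_of_mem_orthogonal hu
      (Submodule.sub_starProjection_mem_orthogonal w), mul_zero]
  obtain ⟨h1, h2⟩ := Classical.epsilon_spec hex
  refine ⟨localProj f x L.direction w, h1, fun u hu => ?_, ?_⟩
  · have h3 := h2 u hu
    rw [hinner, mul_eq_zero, or_iff_right hc.ne', inner_sub_right, sub_eq_zero] at h3
    rw [← real_inner_smul_right, ← hw']
    exact h3.symm
  · rw [newtonDecrement, localNorm, hinner, real_inner_self_eq_norm_sq,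
      Real.sqrt_mul hc.le, Real.sqrt_sq (norm_nonneg _)]

end Newton

theorem mem_solutionSet {E F : Type} [AddCommGroup E] [Module ℝ E] [AddCommGroup F] [Module ℝ F]
    {T : E →ₗ[ℝ] F} {c : F} {x : E} : x ∈ solutionSet T c ↔ T x = c := Iff.rfl

/-- A point is required because an empty affine subspace has direction `⊥`, whatever the kernel. -/
theorem direction_solutionSet {E F : Type} [AddCommGroup E] [Module ℝ E] [AddCommGroup F]
    [Module ℝ F] {T : E →ₗ[ℝ] F} {c : F} {x : E} (hx : x ∈ solutionSet T c) :
    (solutionSet T c).direction = LinearMap.ker T := by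
  ext u
  rw [← AffineSubspace.vadd_mem_iff_mem_direction u hx, LinearMap.mem_ker, mem_solutionSet,
    vadd_eq_add, map_add, mem_solutionSet.1 hx, add_eq_right]

namespace SymMat

variable {ι : Type} [Fintype ι] [DecidableEq ι]

theorem posDef_smul_id {a : ℝ} (ha : 0 < a) : (a • (id : SymMat ι)).mat.PosDef := by
  rw [map_smul, mat_id]
  exact Matrix.PosDef.one.smul ha

theorem inv_smul_id {a : ℝ} (ha : a ≠ 0) : (a • (id : SymMat ι)).inv = a⁻¹ • id := by
  apply mat_injective
  rw [mat_inv, map_smul, map_smul, mat_id]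
  refine Matrix.inv_eq_right_inv ?_
  simp [smul_smul, ha]

theorem hasFDerivAt_inv_smul_id {a : ℝ} (ha : 0 < a) :
    HasFDerivAt (inv : SymMat ι → SymMat ι)
      (-((a⁻¹ ^ 2) • ContinuousLinearMap.id ℝ (SymMat ι))) (a • id) := by
  refine (hasFDerivAt_inv (posDef_smul_id ha).isUnit).congr_fderiv ?_
  congr 1
  ext1 U
  apply mat_injective
  have h : (a • (id : SymMat ι)).mat⁻¹ = a⁻¹ • 1 := by
    rw [← mat_inv, inv_smul_id ha.ne', map_smul, mat_id]
  change (congruence _ U).mat = (a⁻¹ ^ 2 • U).mat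
  rw [mat_congruence, h, map_smul]
  simp [smul_smul, pow_two]

end SymMat

/-! ### The factor-width barrier and the trace bound -/

section Barrier

variable {n k : ℕ}

theorem hasGradientAt_fFW {Y : SymBlocks n k} (hY : ∀ J, (Y J).mat.PosDef) :
    HasGradientAt (fFW n k) (WithLp.toLp 2 fun J => -(Y J).inv) Y := by
  rw [hasGradientAt_iff_hasFDerivAt]
  have h : ∀ J, HasFDerivAt (fun W : SymBlocks n k => Real.log (W J).mat.det)
      ((InnerProductSpace.toDual ℝ (SymMat (Fin k)) (Y J).inv) ∘L
        (PiLp.proj 2 (fun _ : Blocks n k => SymMat (Fin k)) J)) Y := fun J =>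
    HasFDerivAt.comp (g := fun W : SymMat (Fin k) => Real.log W.mat.det) Y
      (hasGradientAt_iff_hasFDerivAt.1 (SymMat.hasGradientAt_log_det (hY J)))
      (PiLp.hasFDerivAt_apply (𝕜 := ℝ) 2 Y J)
  refine (HasFDerivAt.fun_sum fun J _ => h J).neg.congr_fderiv ?_
  ext1 U
  simp [PiLp.inner_apply]

theorem choose_pos (hk : 2 ≤ k) (hkn : k ≤ n) : (0 : ℝ) < (n - 1).choose (k - 1) := by
  exact_mod_cast Nat.choose_pos (by omega)

theorem hasFDerivAt_gradient_fFW (hk : 2 ≤ k) (hkn : k ≤ n) :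
    HasFDerivAt (gradient (fFW n k))
      ((((n - 1).choose (k - 1) : ℝ) ^ 2) • ContinuousLinearMap.id ℝ (SymBlocks n k))
      (Y0 n k) := by
  have hc := choose_pos hk hkn
  have hY0 : ∀ J, (Y0 n k J).mat.PosDef := fun J => SymMat.posDef_smul_id (inv_pos.2 hc)
  have hev : ∀ᶠ Y in nhds (Y0 n k), ∀ J, (Y J).mat.PosDef := by
    rw [Filter.eventually_all]
    intro J
    have hcont : ContinuousAt (fun Y : SymBlocks n k => Y J) (Y0 n k) :=
      (PiLp.hasFDerivAt_apply (𝕜 := ℝ) 2 (Y0 n k) J).continuousAt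
    exact hcont.eventually (SymMat.eventually_posDef (hY0 J))
  have hgrad : gradient (fFW n k) =ᶠ[nhds (Y0 n k)]
      fun Y => WithLp.toLp 2 fun J => -(Y J).inv := by
    filter_upwards [hev] with Y hY
    exact (hasGradientAt_fFW hY).gradient
  refine HasFDerivAt.congr_of_eventuallyEq ?_ hgrad
  rw [← hasFDerivWithinAt_univ, hasFDerivWithinAt_piLp]
  intro J
  rw [hasFDerivWithinAt_univ]
  have h := ((SymMat.hasFDerivAt_inv_smul_id (ι := Fin k) (inv_pos.2 hc)).comp (Y0 n k)
    (PiLp.hasFDerivAt_apply (𝕜 := ℝ) 2 (Y0 n k) J)).neg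
  refine h.congr_fderiv ?_
  ext1 U
  simp

theorem trace_expand (J : Blocks n k) (S : Matrix (Fin k) (Fin k) ℝ) :
    (expand J S).trace = S.trace := by
  have h : ∀ i, (expand J S) i i = if h : i ∈ J.1 then
      S ((J.1.orderIsoOfFin J.2).symm ⟨i, h⟩) ((J.1.orderIsoOfFin J.2).symm ⟨i, h⟩) else 0 := by
    intro i
    by_cases hi : i ∈ J.1 <;> simp [expand, hi]
  simp only [Matrix.trace, Matrix.diag, h]
  rw [← (J.1.orderIsoOfFin J.2).symm.toEquiv.sum_comp, Finset.univ_eq_attach]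
  rw [← Finset.sum_subset (Finset.subset_univ J.1), ← Finset.sum_attach]
  · refine Finset.sum_congr rfl fun i _ => ?_
    simp
  · intro i _ hi
    simp [hi]

/-- Expanding a block preserves its trace, so pairing with 𝒴₀ sees only the trace of the image under
Ψ. -/
theorem inner_Y0 (Y : SymBlocks n k) :
    ⟪Y, Y0 n k⟫_ℝ = ((n - 1).choose (k - 1) : ℝ)⁻¹ * (Psi n k Y).mat.trace := by
  have h : (Psi n k Y).mat.trace = ∑ J, (Y J).mat.trace := by
    change (SymMat.mat (∑ J, expandSym J (Y J))).trace = _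
    rw [map_sum, Matrix.trace_sum]
    exact Finset.sum_congr rfl fun J _ => trace_expand J _
  rw [PiLp.inner_apply, h, Finset.mul_sum]
  refine Finset.sum_congr rfl fun J _ => ?_
  change ⟪Y J, _ • SymMat.id⟫_ℝ = _
  rw [inner_smul_right, SymMat.inner_id]

/-- The number of index sets of size `k` that contain both `i` and `j`. -/
def pairCount (k : ℕ) (i j : Fin n) : ℕ :=
  (Finset.univ.filter fun J : Blocks n k => i ∈ J.1 ∧ j ∈ J.1).card

theorem pairCount_comm (i j : Fin n) : pairCount k i j = pairCount k j i := by
  simp only [pairCount, and_comm]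

/-- Since 2 ≤ k, any two indices fit into a common block; this is what makes Ψ surjective. -/
theorem pairCount_pos (hk : 2 ≤ k) (hkn : k ≤ n) (i j : Fin n) : 0 < pairCount k i j := by
  obtain ⟨J, hJ, -, hJk⟩ := Finset.exists_subsuperset_card_eq (Finset.subset_univ {i, j})
    (Finset.card_le_two.trans hk) (by simpa using hkn)
  refine Finset.card_pos.2 ⟨⟨J, hJk⟩, ?_⟩
  simp only [Finset.mem_filter, Finset.mem_univ, true_and]
  exact ⟨hJ (by simp), hJ (by simp)⟩

/-- A preimage of `Z` under `Psi`: every entry of `Z` is spread evenly over the blocks that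
contain its position. -/
def spread (k : ℕ) (Z : SymMat (Fin n)) : SymBlocks n k :=
  WithLp.toLp 2 fun J => SymMat.mk
    (Matrix.of fun a b => (pairCount k (J.1.orderIsoOfFin J.2 a : Fin n)
      (J.1.orderIsoOfFin J.2 b : Fin n) : ℝ)⁻¹ *
        Z.mat (J.1.orderIsoOfFin J.2 a) (J.1.orderIsoOfFin J.2 b))
    (by
      ext a b
      simp only [Matrix.transpose_apply, Matrix.of_apply]
      rw [pairCount_comm, Z.isSymm.apply])

theorem mat_spread_apply (Z : SymMat (Fin n)) (J : Blocks n k) (a b : Fin k) :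
    (spread k Z J).mat a b = (pairCount k (J.1.orderIsoOfFin J.2 a : Fin n)
      (J.1.orderIsoOfFin J.2 b : Fin n) : ℝ)⁻¹ *
        Z.mat (J.1.orderIsoOfFin J.2 a) (J.1.orderIsoOfFin J.2 b) := rfl

theorem sum_ite_pair (i j : Fin n) (x : ℝ) :
    (∑ J : Blocks n k, if i ∈ J.1 ∧ j ∈ J.1 then x else 0) = pairCount k i j * x := by
  rw [← Finset.sum_filter, Finset.sum_const, nsmul_eq_mul, pairCount]

theorem Psi_spread (hk : 2 ≤ k) (hkn : k ≤ n) (Z : SymMat (Fin n)) :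
    Psi n k (spread k Z) = Z := by
  apply SymMat.mat_injective
  ext i j
  have h : ∀ J : Blocks n k, (expandSym J (spread k Z J)).mat i j =
      if i ∈ J.1 ∧ j ∈ J.1 then (pairCount k i j : ℝ)⁻¹ * Z.mat i j else 0 := by
    intro J
    change expand J _ i j = _
    by_cases hij : i ∈ J.1 ∧ j ∈ J.1
    · simp [expand, hij, mat_spread_apply]
    · simp [expand, hij]
  change (SymMat.mat (∑ J, expandSym J (spread k Z J))) i j = _
  rw [map_sum, Matrix.sum_apply, Finset.sum_congr rfl fun J _ => h J, sum_ite_pair,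
    mul_inv_cancel_left₀]
  exact_mod_cast (pairCount_pos hk hkn i j).ne'

/-- An entry z shared among c ≥ 1 blocks contributes c(z/c)² = z²/c ≤ z² to the squared norm. -/
theorem norm_spread_le (hk : 2 ≤ k) (hkn : k ≤ n) (Z : SymMat (Fin n)) :
    ‖spread k Z‖ ≤ ‖Z‖ := by
  refine (pow_le_pow_iff_left₀ (norm_nonneg _) (norm_nonneg _) two_ne_zero).1 ?_
  have hsum : ∀ (J : Blocks n k) (g : Fin n → ℝ),
      ∑ a, g (J.1.orderIsoOfFin J.2 a) = ∑ i, if i ∈ J.1 then g i else 0 := fun J g => by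
    refine ((J.1.orderIsoOfFin J.2).toEquiv.sum_comp (fun i : J.1 => g i)).trans ?_
    rw [Finset.univ_eq_attach, Finset.sum_attach J.1 g, ← Finset.sum_filter]
    simp
  have hJ : ∀ J : Blocks n k, ‖spread k Z J‖ ^ 2 = ∑ i, ∑ j,
      if i ∈ J.1 ∧ j ∈ J.1 then ((pairCount k i j : ℝ)⁻¹ * Z.mat i j) ^ 2 else 0 := fun J => by
    rw [SymMat.norm_sq_eq_sum]
    simp only [mat_spread_apply]
    have h1 : ∀ i : Fin n, (∑ b, ((pairCount k i (J.1.orderIsoOfFin J.2 b) : ℝ)⁻¹ *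
        Z.mat i (J.1.orderIsoOfFin J.2 b)) ^ 2) = _ := fun i =>
      hsum J fun j => ((pairCount k i j : ℝ)⁻¹ * Z.mat i j) ^ 2
    simp only [h1]
    rw [hsum J fun i => ∑ j, if j ∈ J.1 then ((pairCount k i j : ℝ)⁻¹ * Z.mat i j) ^ 2 else 0]
    refine Finset.sum_congr rfl fun i _ => ?_
    by_cases hi : i ∈ J.1 <;> simp [hi]
  rw [PiLp.norm_sq_eq_of_L2, SymMat.norm_sq_eq_sum, Finset.sum_congr rfl fun J _ => hJ J,
    Finset.sum_comm]
  refine Finset.sum_le_sum fun i _ => ?_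
  rw [Finset.sum_comm]
  refine Finset.sum_le_sum fun j _ => ?_
  rw [sum_ite_pair]
  have hp : (1 : ℝ) ≤ pairCount k i j := by exact_mod_cast pairCount_pos hk hkn i j
  have h2 : (pairCount k i j : ℝ) * ((pairCount k i j : ℝ)⁻¹ * Z.mat i j) ^ 2 =
      (pairCount k i j : ℝ)⁻¹ * Z.mat i j ^ 2 := by
    field_simp
  rw [h2]
  exact mul_le_of_le_one_left (sq_nonneg _) (inv_le_one_of_one_le₀ hp)

/-- A bound for the factor-width Newton decrement bounds the trace on the parallel subspace. -/
theorem abs_trace_le_of_newtonDecrement_le (hk : 2 ≤ k) (hkn : k ≤ n) {F : Type} [AddCommGroup F]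
    [Module ℝ F] {T : SymMat (Fin n) →ₗ[ℝ] F} {c : F} (hne : ∃ W, T W = c) {δ : ℝ}
    (hdec : newtonDecrement (fFW n k) (solutionSet (T ∘ₗ Psi n k) c) (Y0 n k) ≤ δ)
    {Z : SymMat (Fin n)} (hZ : T Z = 0) : |⟪Z, SymMat.id⟫_ℝ| ≤ δ * ‖Z‖ := by
  obtain ⟨W, hW⟩ := hne
  have hmem : spread k W ∈ solutionSet (T ∘ₗ Psi n k) c := by
    rw [mem_solutionSet, LinearMap.comp_apply, Psi_spread hk hkn, hW]
  have hc := choose_pos hk hkn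
  set q : ℝ := ((n - 1).choose (k - 1) : ℝ) with hq
  obtain ⟨p, -, hp, hpdec⟩ := exists_newtonDecrement_eq (pow_pos hc 2)
    (hasFDerivAt_gradient_fFW hk hkn) (solutionSet (T ∘ₗ Psi n k) c)
  rw [direction_solutionSet hmem] at hp
  have hY0 : ∀ J, (Y0 n k J).mat.PosDef := fun J => SymMat.posDef_smul_id (inv_pos.2 hc)
  have hgrad : gradient (fFW n k) (Y0 n k) = -(q ^ 2) • Y0 n k := by
    rw [(hasGradientAt_fFW hY0).gradient]
    ext1 J
    change -(SymMat.inv (q⁻¹ • SymMat.id)) = -(q ^ 2) • (q⁻¹ • SymMat.id)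
    rw [SymMat.inv_smul_id (inv_ne_zero hc.ne'), inv_inv, smul_smul, ← neg_smul]
    congr 1
    field_simp
  -- Testing the projection p against the lift of Z expresses tr Z as -q⟨`spread k Z`, p⟩;
  -- Cauchy–Schwarz finishes.
  have h1 := hp (spread k Z) (by
    rw [LinearMap.mem_ker, LinearMap.comp_apply, Psi_spread hk hkn, hZ])
  rw [hgrad, inner_smul_right, inner_Y0, Psi_spread hk hkn] at h1
  have h2 : Z.mat.trace = -(q * ⟪spread k Z, p⟫_ℝ) := by
    rw [h1, ← hq]
    field_simp
  rw [hpdec, Real.sqrt_sq hc.le] at hdec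
  rw [SymMat.inner_id, h2, abs_neg, abs_mul, abs_of_pos hc]
  calc q * |⟪spread k Z, p⟫_ℝ| ≤ q * (‖spread k Z‖ * ‖p‖) := by
        gcongr
        exact abs_real_inner_le_norm _ _
    _ = q * ‖p‖ * ‖spread k Z‖ := by ring
    _ ≤ δ * ‖Z‖ := mul_le_mul hdec (norm_spread_le hk hkn Z) (norm_nonneg _)
        ((by positivity : 0 ≤ q * ‖p‖).trans hdec)

end Barrier

/-! ### First-order conditions and the critical point of log det -/

theorem hasFDerivAt_nonneg_of_eventually_le {E : Type} [NormedAddCommGroup E] [NormedSpace ℝ E]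
    {f : E → ℝ} {f' : E →L[ℝ] ℝ} {x : E} (hf : HasFDerivAt f f' x) {u : E}
    (h : ∀ᶠ t in nhdsWithin (0 : ℝ) (Set.Ioi 0), f x ≤ f (x + t • u)) : 0 ≤ f' u := by
  have hline : HasDerivAt (fun t : ℝ => f (x + t • u)) (f' u) 0 := by
    have h1 : HasDerivAt (fun t : ℝ => x + t • u) u 0 := by
      simpa using ((hasDerivAt_id (0 : ℝ)).smul_const u).const_add x
    have h2 : HasFDerivAt f f' (x + (0 : ℝ) • u) := by simpa using hf
    exact h2.comp_hasDerivAt 0 h1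
  refine ge_of_tendsto hline.tendsto_slope_zero_right ?_
  filter_upwards [h, self_mem_nhdsWithin] with t ht htpos
  have htpos : 0 < t := htpos
  simp only [zero_add, zero_smul, add_zero, smul_eq_mul]
  exact mul_nonneg (inv_nonneg.2 htpos.le) (sub_nonneg.2 ht)

theorem hasFDerivAt_eq_zero_of_eventually_le {E : Type} [NormedAddCommGroup E] [NormedSpace ℝ E]
    {f : E → ℝ} {f' : E →L[ℝ] ℝ} {x : E} (hf : HasFDerivAt f f' x) {V : Submodule ℝ E}
    (h : ∀ᶠ y in nhds x, y - x ∈ V → f x ≤ f y) {u : E} (hu : u ∈ V) : f' u = 0 := by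
  have key : ∀ w ∈ V, 0 ≤ f' w := fun w hw => by
    refine hasFDerivAt_nonneg_of_eventually_le hf ?_
    have hcont : ContinuousAt (fun t : ℝ => x + t • w) 0 := by fun_prop
    have h0 : ∀ᶠ y in nhds (x + (0 : ℝ) • w), y - x ∈ V → f x ≤ f y := by simpa using h
    filter_upwards [(hcont.eventually h0).filter_mono nhdsWithin_le_nhds] with t ht
    exact ht (by simpa using V.smul_mem t hw)
  have h1 := key u hu
  have h2 := key (-u) (V.neg_mem hu)
  rw [map_neg] at h2
  linarith

namespace SymMat

variable {ι : Type} [Fintype ι] [DecidableEq ι]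

/-- If the trace is small on a subspace of symmetric matrices, then `log det` has a critical point
on the translate of the subspace by the identity. -/
theorem exists_posDef_inv_orthogonal (V : Submodule ℝ (SymMat ι))
    (hV : ∀ U ∈ V, |⟪U, id⟫_ℝ| ≤ 1 / 14 * ‖U‖) :
    ∃ Z : SymMat ι, Z.mat.PosDef ∧ Z - id ∈ V ∧ ∀ U ∈ V, ⟪Z.inv, U⟫_ℝ = 0 := by
  -- A radius below 1 keeps K inside the positive definite cone; a radius above 1/13 will make the
  -- maximizer interior.
  set K : Set (SymMat ι) := {W | W - id ∈ V} ∩ Metric.closedBall id (1 / 2) with hK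
  have hKpos : ∀ W ∈ K, W.mat.PosDef := fun W hW =>
    posDef_of_norm_sub_id_lt (by
      have := mem_closedBall_iff_norm.1 hW.2
      linarith)
  have hcomp : IsCompact K := by
    refine (isCompact_closedBall _ _).inter_left ?_
    exact V.closed_of_finiteDimensional.preimage (continuous_id.sub continuous_const)
  have hne : K.Nonempty := ⟨id, by simp, by simp⟩
  have hcont : ContinuousOn (fun W : SymMat ι => Real.log W.mat.det) K := fun W hW =>
    (hasGradientAt_log_det (hKpos W hW)).continuousAt.continuousWithinAt
  obtain ⟨Z, hZK, hmax⟩ := hcomp.exists_isMaxOn hne hcont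
  have hZ := hKpos Z hZK
  have hZV : Z - id ∈ V := hZK.1
  have hderiv := (hasGradientAt_iff_hasFDerivAt.1 (hasGradientAt_log_det hZ)).neg
  have h1 : 0 ≤ ⟪Z.inv, Z - id⟫_ℝ := by
    -- The segment from Z to I stays in K, so this one-sided condition holds even if Z were on the
    -- boundary of the ball.
    have h2 := hasFDerivAt_nonneg_of_eventually_le hderiv (u := id - Z) (by
      filter_upwards [Ioc_mem_nhdsGT (zero_lt_one (α := ℝ))] with t ht
      refine neg_le_neg (hmax ?_)
      have h3 : Z + t • (id - Z) - id = (1 - t) • (Z - id) := by module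
      refine ⟨?_, ?_⟩
      · change _ - _ ∈ V
        rw [h3]
        exact V.smul_mem _ hZV
      · rw [mem_closedBall_iff_norm, h3, norm_smul, Real.norm_of_nonneg (by linarith [ht.2])]
        have h4 := mem_closedBall_iff_norm.1 hZK.2
        nlinarith [ht.1, ht.2, norm_nonneg (Z - id)])
    have h5 : -⟪Z.inv, id - Z⟫_ℝ = ⟪Z.inv, Z - id⟫_ℝ := by rw [← inner_neg_right, neg_sub]
    rw [← h5]
    exact h2
  -- The stability estimate makes the ball constraint inactive, so Z is critical along all of V.
  have hr := (norm_sub_id_le hZ h1 ((le_abs_self _).trans (hV _ hZV))).1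
  refine ⟨Z, hZ, hZV, fun U hU => ?_⟩
  have h6 := hasFDerivAt_eq_zero_of_eventually_le hderiv (V := V) (by
    have hnear : ∀ᶠ W in nhds Z, ‖W - id‖ < 1 / 2 :=
      (continuous_id.sub continuous_const).norm.continuousAt.eventually_lt_const (hr.trans_lt (by norm_num))
    filter_upwards [hnear] with W hW hWV
    refine neg_le_neg (hmax ⟨?_, mem_closedBall_iff_norm.2 hW.le⟩)
    have := V.add_mem hWV hZV
    rwa [sub_add_sub_cancel] at this) hU
  exact neg_eq_zero.1 h6

end SymMat

/-! ### The central path and the final decrement bound -/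

section SDP

variable {n m : ℕ}

open scoped MatrixOrder in
-- By cyclicity of the trace, rescaling moves the iterate X to I. No inverse of X is needed, so
-- semidefiniteness suffices.
theorem inner_rescale_id {X : SymMat (Fin n)} (hX : X.mat.PosSemidef) (A : SymMat (Fin n)) :
    ⟪rescale X A, SymMat.id⟫_ℝ = ⟪A, X⟫_ℝ := by
  rw [SymMat.inner_id, SymMat.inner_def]
  change (CFC.sqrt X.mat * A.mat * CFC.sqrt X.mat).trace = _
  rw [Matrix.trace_mul_comm, ← Matrix.mul_assoc,
    CFC.sqrt_mul_sqrt_self X.mat (Matrix.nonneg_iff_posSemidef.2 hX), Matrix.trace_mul_comm]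

theorem traceOp_eq_iff {κ : Type} {B : κ → SymMat (Fin n)} {Z : SymMat (Fin n)} {c : κ → ℝ} :
    traceOp B Z = c ↔ ∀ i, ⟪B i, Z⟫_ℝ = c i := funext_iff

theorem hasGradientAt_fSDP (A0 X : SymMat (Fin n)) (η : ℝ) {Z : SymMat (Fin n)}
    (hZ : Z.mat.PosDef) : HasGradientAt (fSDP A0 X η) (η • rescale X A0 - Z.inv) Z := by
  rw [hasGradientAt_iff_hasFDerivAt, map_sub]
  refine HasFDerivAt.sub ?_ (hasGradientAt_iff_hasFDerivAt.1 (SymMat.hasGradientAt_log_det hZ))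
  refine ((InnerProductSpace.toDual ℝ _ (η • rescale X A0)).hasFDerivAt).congr_of_eventuallyEq
    (Filter.Eventually.of_forall fun W => ?_)
  simp

theorem hasFDerivAt_gradient_fSDP (A0 X : SymMat (Fin n)) (η : ℝ) :
    HasFDerivAt (gradient (fSDP A0 X η)) ((1 : ℝ) • ContinuousLinearMap.id ℝ (SymMat (Fin n)))
      SymMat.id := by
  have hid : (SymMat.id : SymMat (Fin n)).mat.PosDef := Matrix.PosDef.one
  have hgrad : gradient (fSDP A0 X η) =ᶠ[nhds SymMat.id] fun Z => η • rescale X A0 - Z.inv := by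
    filter_upwards [SymMat.eventually_posDef hid] with Z hZ
    exact (hasGradientAt_fSDP A0 X η hZ).gradient
  have h := SymMat.hasFDerivAt_inv_smul_id (ι := Fin n) zero_lt_one
  rw [one_smul] at h
  refine ((h.const_sub (η • rescale X A0)).congr_fderiv ?_).congr_of_eventuallyEq hgrad
  simp

/-- A critical point of `log det` on the intersection of `L_ℓ` with a level set of the objective is
a point of the central path. -/
theorem exists_isCentralParameter {A : Fin (m + 1) → SymMat (Fin n)} {b : Fin m → ℝ}
    {X Z : SymMat (Fin n)} {v : ℝ} (hZ : Z.mat.PosDef)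
    (hZL : traceOp (fun i => rescale X (A i)) Z = (Fin.cons v b : Fin (m + 1) → ℝ))
    (hcrit : ∀ U ∈ LinearMap.ker (traceOp fun i => rescale X (A i)), ⟪Z.inv, U⟫_ℝ = 0) :
    ∃ η, IsCentralParameter A b X v η := by
  rw [traceOp_eq_iff] at hZL
  -- Lagrange multipliers: Z⁻¹ is orthogonal to the common kernel of the functionals, hence in their
  -- span. The multiplier `y 0` of the objective serves as η.
  have hspan : Z.inv ∈ Submodule.span ℝ (Set.range fun i => rescale X (A i)) := by
    rw [← Submodule.orthogonal_orthogonal (Submodule.span ℝ _), Submodule.mem_orthogonal']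
    refine fun U hU => hcrit U ?_
    rw [LinearMap.mem_ker, traceOp_eq_iff]
    exact fun i => Submodule.inner_right_of_mem_orthogonal
      (Submodule.subset_span (Set.mem_range_self i)) hU
  obtain ⟨y, hy⟩ := (Submodule.mem_span_range_iff_exists_fun ℝ).1 hspan
  refine ⟨y 0, Z, ?_, hZ, by simpa using hZL 0, fun W hW hWpos => ?_⟩
  · rw [Lell, mem_solutionSet, traceOp_eq_iff]
    exact fun i => by simpa using hZL i.succ
  · rw [Lell, mem_solutionSet, traceOp_eq_iff] at hW
    have h1 := SymMat.log_det_le_add_inner hWpos hZ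
    have h2 : ⟪Z.inv, W - Z⟫_ℝ =
        y 0 * ⟪rescale X (A 0), W⟫_ℝ - y 0 * ⟪rescale X (A 0), Z⟫_ℝ := by
      rw [← hy, sum_inner, Fin.sum_univ_succ, Finset.sum_eq_zero, add_zero, real_inner_smul_left,
        inner_sub_right, mul_sub]
      intro i _
      rw [real_inner_smul_left, inner_sub_right, hW i, hZL i.succ, Fin.cons_succ, sub_self,
        mul_zero]
    simp only [fSDP]
    linarith

/-- Optimality of Z makes ηA_0^(ℓ) - Z⁻¹ orthogonal to the direction of L_ℓ. There the gradient
ηA_0^(ℓ) - I at the identity acts as Z⁻¹ - I, whose norm is at most 1/12. -/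
theorem newtonDecrement_fSDP_le {A : Fin (m + 1) → SymMat (Fin n)} {b : Fin m → ℝ}
    {X : SymMat (Fin n)} {v η : ℝ}
    (hid : traceOp (fun i => rescale X (A i)) SymMat.id = (Fin.cons v b : Fin (m + 1) → ℝ))
    (htr : ∀ U ∈ LinearMap.ker (traceOp fun i => rescale X (A i)),
      |⟪U, SymMat.id⟫_ℝ| ≤ 1 / 14 * ‖U‖)
    (hη : IsCentralParameter A b X v η) :
    newtonDecrement (fSDP (A 0) X η) (Lell A b X) SymMat.id ≤ 1 / 12 := by
  obtain ⟨Z, hZL, hZ, hZv, hmin⟩ := hη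
  rw [traceOp_eq_iff] at hid
  have hidL : SymMat.id ∈ Lell A b X := by
    rw [Lell, mem_solutionSet, traceOp_eq_iff]
    exact fun i => by simpa using hid i.succ
  have hcrit : ∀ U ∈ (Lell A b X).direction, ⟪η • rescale X (A 0) - Z.inv, U⟫_ℝ = 0 := by
    intro U hU
    refine hasFDerivAt_eq_zero_of_eventually_le
      (hasGradientAt_iff_hasFDerivAt.1 (hasGradientAt_fSDP (A 0) X η hZ)) ?_ hU
    filter_upwards [SymMat.eventually_posDef hZ] with W hW hWZ
    refine hmin W ?_ hW
    have := AffineSubspace.vadd_mem_of_mem_direction hWZ hZL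
    rwa [vadd_eq_add, sub_add_cancel] at this
  have hZdir : Z - SymMat.id ∈ (Lell A b X).direction :=
    AffineSubspace.vsub_mem_direction hZL hidL
  have h0 : ⟪rescale X (A 0), Z - SymMat.id⟫_ℝ = 0 := by
    have := hid 0
    rw [Fin.cons_zero] at this
    rw [inner_sub_right, hZv, this, sub_self]
  -- Z and I share the objective value v, so Z - I lies in the smaller kernel, where the trace bound
  -- applies.
  have hZker : Z - SymMat.id ∈ LinearMap.ker (traceOp fun i => rescale X (A i)) := by
    rw [Lell, direction_solutionSet hidL, LinearMap.mem_ker, traceOp_eq_iff] at hZdir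
    rw [LinearMap.mem_ker, traceOp_eq_iff]
    exact Fin.cases h0 hZdir
  have h1 : ⟪Z.inv, Z - SymMat.id⟫_ℝ = 0 := by
    have := hcrit _ hZdir
    rwa [inner_sub_left, real_inner_smul_left, h0, mul_zero, zero_sub, neg_eq_zero] at this
  have hclose := (SymMat.norm_sub_id_le hZ h1.ge ((le_abs_self _).trans (htr _ hZker))).2
  obtain ⟨p, hp, hpu, hdec⟩ := exists_newtonDecrement_eq zero_lt_one
    (hasFDerivAt_gradient_fSDP (A 0) X η) (Lell A b X)
  rw [hdec, Real.sqrt_one, one_mul]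
  have hinv : (SymMat.id : SymMat (Fin n)).inv = SymMat.id := by
    simpa using SymMat.inv_smul_id (ι := Fin n) one_ne_zero
  have h2 := hpu p hp
  rw [(hasGradientAt_fSDP (A 0) X η Matrix.PosDef.one).gradient, hinv, inv_one, one_mul,
    real_inner_self_eq_norm_sq] at h2
  have h3 := hcrit p hp
  rw [real_inner_comm, inner_sub_right] at h3
  have h4 : ‖p‖ ^ 2 = ⟪p, Z.inv - SymMat.id⟫_ℝ := by
    rw [h2, inner_sub_right, inner_sub_right]
    linarith
  have h5 := real_inner_le_norm p (Z.inv - SymMat.id)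
  have h6 : ‖p‖ * ‖p‖ ≤ ‖p‖ * (1 / 12) := by
    rw [← pow_two, h4]
    exact h5.trans (by gcongr)
  rcases (norm_nonneg p).eq_or_lt with h7 | h7
  · rw [← h7]
    norm_num
  · exact le_of_mul_le_mul_left h6 h7

end SDP

end FactorWidth

end

theorem mainTheorem3 (n k m : ℕ) (hn : 0 < n) (hk : 2 ≤ k) (hkn : k ∣ n)
    (A : Fin (m + 1) → SymMat (Fin n)) (b : Fin m → ℝ)
    (X : SymMat (Fin n)) (hX : X.mat.PosSemidef)
    (hfeas : ∀ i : Fin m, inner ℝ (A i.succ) X = b i)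
    (v : ℝ) (hv : inner ℝ (A 0) X = v)
    (hdec : newtonDecrement (fFW n k) (LPsi k A b X v) (Y0 n k) ≤ 1 / 14) :
    (∃ η : ℝ, IsCentralParameter A b X v η) ∧
      ∀ η : ℝ, IsCentralParameter A b X v η →
        newtonDecrement (fSDP (A 0) X η) (Lell A b X) SymMat.id ≤ 1 / 9 := by
  have hid : traceOp (fun i => rescale X (A i)) SymMat.id =
      (Fin.cons v b : Fin (m + 1) → ℝ) := by
    rw [traceOp_eq_iff]
    refine Fin.cases ?_ fun i => ?_
    · rw [inner_rescale_id hX, hv, Fin.cons_zero]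
    · rw [inner_rescale_id hX, hfeas, Fin.cons_succ]
  have htr : ∀ U ∈ LinearMap.ker (traceOp fun i => rescale X (A i)),
      |inner ℝ U SymMat.id| ≤ 1 / 14 * ‖U‖ := fun U hU =>
    abs_trace_le_of_newtonDecrement_le hk (Nat.le_of_dvd hn hkn) ⟨SymMat.id, hid⟩ hdec
      (LinearMap.mem_ker.1 hU)
  refine ⟨?_, fun η hη => (newtonDecrement_fSDP_le hid htr hη).trans (by norm_num)⟩
  obtain ⟨Z, hZ, hZV, hcrit⟩ := SymMat.exists_posDef_inv_orthogonal _ htr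
  refine exists_isCentralParameter hZ ?_ hcrit
  rw [LinearMap.mem_ker, map_sub, sub_eq_zero] at hZV
  rw [hZV, hid]
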